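/- Let $\mathcal V$ be a finite set of variables, $\mathcal D$ a set of locations, and $C=(C_{ij})_{i,j\in\mathcal V}$ a cross-covariance function on $\mathcal D$, i.e. functions $C_{ij}:\mathcal D\times\mathcal D\to\mathbb R$ such that for every finite $S\subset\mathcal D$ the matrix $C(S,S)=(C_{ij}(s,s'))_{(i,s),(j,s')\in\mathcal V\times S}$ is symmetric positive definite. Let $\mathcal G_{\mathcal V}=(\mathcal V,E_{\mathcal V})$ be a simple graph and $\mathcal L\subset\mathcal D$ a finite set. A process $w=(w_i(s))_{i\in\mathcal V,\,s\in\mathcal D}$ is called *stitched* from $C,\mathcal G_{\mathcal V},\mathcal L$ if: 1. $w(\mathcal L)\sim N(0,F)$, where $F$ is a covariance selection of $C(\mathcal L,\mathcal L)$ along the strong product $\mathcal G_{\mathcal V}\boxtimes\mathcal G_{\mathcal L}$ of $\mathcal G_{\mathcal V}$ with the complete graph $\mathcal G_{\mathcal L}$ on $\mathcal L$: $F$ is positive definite, agrees with $C(\mathcal L,\mathcal L)$ on the diagonal and on the edges of $\mathcal G_{\mathcal V}\boxtimes\mathcal G_{\mathcal L}$, and $F^{-1}$ vanishes at all its off-diagonal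 non-edges; 2. for $s\in\mathcal D\setminus\mathcal L$, $w_i(s)=C_{ii}(s,\mathcal L)C_{ii}(\mathcal L,\mathcal L)^{-1}w_i(\mathcal L)+z_i(s)$, where $z_i\sim GP(0,C_{ii|\mathcal L})$ with $C_{ii|\mathcal L}(s,s')=C_{ii}(s,s')-C_{ii}(s,\mathcal L)C_{ii}(\mathcal L,\mathcal L)^{-1}C_{ii}(\mathcal L,s')$, and the processes $z_i$ $(i\in\mathcal V)$ are mutually independent and jointly independent of $w(\mathcal L)$. Then a stitched process exists on some probability space, and there is a single cross-covariance function $M$ (so $M(S,S)$ is positive definite for every finite $S\subset\mathcal D$) such that every stitched process $w$ is a centred multivariate Gaussian process with cross-covariance function $M$, and (a) $w_i\sim GP(0,C_{ii})$ for each $i$, i.e. $M_{ii}(s,s')=C_{ii}(s,s')$ for all $s,s'\in\mathcal D$; (b) $w$ is a graphical Gaussian process with respect to $\mathcal G_{\mathcal V}$ on $\mathcal D$: for all $i\ne j$ with $(i,j)\notin E_{\mathcal V}$ and all $s,s'\in\mathcal D$, $$\operatorname{Cov}\bigl(w_i(s)-\mathbb E[w_i(s)\mid\mathcal A_{ij}],\;w_j(s')-\mathbb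 E[w_j(s')\mid\mathcal A_{ij}]\bigr)=0,\qquad \mathcal A_{ij}=\sigma\{w_k(t):k\in\mathcal V\setminus\{i,j\},\ t\in\mathcal D\};$$ (c) if $(i,j)\in E_{\mathcal V}$, then $M_{ij}(s,s')=C_{ij}(s,s')$ for all $s,s'\in\mathcal L$. -/

import Mathlib

open MeasureTheory ProbabilityTheory Matrix

universe u v x

noncomputable section

namespace Stitching

/-- The matrix `C(S, S)` of a `V × V` matrix-valued function `C = (C i j)` on `D × D`, restricted to
a finite set `S` of locations; rows and columns are indexed by variable-location pairs. -/
def crossCovMatrix {V D : Type*} (C : V → V → D → D → ℝ) (S : Finset D) :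
    Matrix (V × S) (V × S) ℝ :=
  Matrix.of fun p p' => C p.1 p'.1 p.2 p'.2

/-- `C` is a (valid) cross-covariance function: for every finite set `S` of locations the matrix
`C(S, S)` is (symmetric) positive definite. -/
def IsCrossCovariance {V D : Type*} (C : V → V → D → D → ℝ) : Prop :=
  ∀ S : Finset D, (crossCovMatrix C S).PosDef

/-- `X ~ GP(0, K)`: a family of real random variables indexed by `T` with Gaussian
finite-dimensional distributions, mean zero and covariance function `K`.
For a finite index type `T` this says `X ~ N(0, K)`. -/
structure IsCenteredGP {T Ω : Type*} [MeasurableSpace Ω] (X : T → Ω → ℝ) (K : T → T → ℝ)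
    (P : Measure Ω) : Prop where
  measurable : ∀ t, Measurable (X t)
  gaussian : IsGaussianProcess X P
  mean_zero : ∀ t, ∫ ω, X t ω ∂P = 0
  covariance_eq : ∀ t t', covariance (X t) (X t') P = K t t'

/-- The strong product `G ⊠ H` of two graphs. -/
def strongProduct {α β : Type*} (G : SimpleGraph α) (H : SimpleGraph β) :
    SimpleGraph (α × β) where
  Adj x y := (x.1 = y.1 ∧ H.Adj x.2 y.2) ∨ (x.2 = y.2 ∧ G.Adj x.1 y.1) ∨
    (G.Adj x.1 y.1 ∧ H.Adj x.2 y.2)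
  symm := ⟨fun x y h => by
    rcases h with ⟨h₁, h₂⟩ | ⟨h₁, h₂⟩ | ⟨h₁, h₂⟩
    · exact Or.inl ⟨h₁.symm, h₂.symm⟩
    · exact Or.inr (Or.inl ⟨h₁.symm, h₂.symm⟩)
    · exact Or.inr (Or.inr ⟨h₁.symm, h₂.symm⟩)⟩
  loopless := ⟨fun x h => by
    rcases h with ⟨_, h⟩ | ⟨_, h⟩ | ⟨h, _⟩
    · exact H.irrefl h
    · exact G.irrefl h
    · exact G.irrefl h⟩

/-- `F'` is the covariance selection of `F` along the graph `G`: a positive definite matrix that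
agrees with `F` on the diagonal and on the edges of `G`, and whose inverse vanishes at the
off-diagonal non-edges of `G`. -/
structure IsCovarianceSelection {S : Type*} [Fintype S] [DecidableEq S] (G : SimpleGraph S)
    (F F' : Matrix S S ℝ) : Prop where
  posDef : F'.PosDef
  eq_diag : ∀ r, F' r r = F r r
  eq_adj : ∀ r s, G.Adj r s → F' r s = F r s
  inv_eq_zero : ∀ r s, r ≠ s → ¬ G.Adj r s → F'⁻¹ r s = 0

/-- The predictor `K(s, L) K(L, L)⁻¹ x` at the location `s`, from the values `x` on the finite
set `L`. -/
def predictor {D : Type*} [DecidableEq D] (K : D → D → ℝ) (L : Finset D) (s : D) (x : L → ℝ) : ℝ :=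
  (fun l : L => K s l) ⬝ᵥ ((Matrix.of fun l l' : L => K l l')⁻¹ *ᵥ x)

/-- The residual covariance function `K(s, s') - K(s, L) K(L, L)⁻¹ K(L, s')`. -/
def residualCov {D : Type*} [DecidableEq D] (K : D → D → ℝ) (L : Finset D) (s s' : D) : ℝ :=
  K s s' - predictor K L s (fun l : L => K l s')

/-- `w` is produced by stitching from the cross-covariance function `C`, the inter-variable graph
`G` and the finite set `L` of locations. -/
structure IsStitched {V D Ω : Type*} [Fintype V] [DecidableEq V] [DecidableEq D]
    [MeasurableSpace Ω] (C : V → V → D → D → ℝ) (G : SimpleGraph V) (L : Finset D)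
    (P : Measure Ω) (w : V → D → Ω → ℝ) : Prop where
  measurable : ∀ i s, Measurable (w i s)
  /-- `w(L) ~ N(0, F)`, where `F` is the covariance selection of `C(L, L)` along the strong product
  of `G` with the complete graph on `L`. -/
  onL : ∃ F : Matrix (V × L) (V × L) ℝ,
    IsCovarianceSelection (strongProduct G (⊤ : SimpleGraph L)) (crossCovMatrix C L) F ∧
    IsCenteredGP (fun p : V × L => w p.1 p.2) F P
  /-- Off `L`, `w i` is its predictive process plus a residual `z i ~ GP(0, C i i | L)`; the
  processes `z i` are mutually independent, and jointly independent of `w(L)`. -/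
  offL : ∃ z : V → D → Ω → ℝ,
    (∀ i, IsCenteredGP (z i) (residualCov (C i i) L) P) ∧
    iIndepFun (fun (i : V) (ω : Ω) (s : D) => z i s ω) P ∧
    IndepFun (fun (ω : Ω) (p : V × D) => z p.1 p.2 ω)
      (fun (ω : Ω) (p : V × L) => w p.1 p.2 ω) P ∧
    ∀ i, ∀ s, s ∉ L → ∀ ω, w i s ω = predictor (C i i) L s (fun l : L => w i l ω) + z i s ω

/-- The σ-algebra generated by `w k s`, over all `k ∉ {i, j}` and all locations `s`. -/
abbrev sigmaOthers {V D Ω : Type*} (w : V → D → Ω → ℝ) (i j : V) : MeasurableSpace Ω :=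
  ⨆ (k : V) (_ : k ≠ i ∧ k ≠ j) (s : D), MeasurableSpace.comap (w k s) inferInstance

/-- Process-level conditional independence of `w i` and `w j` given the other components: the
residuals of `w i s` and `w j s'` after conditioning on all the other processes, over
the whole domain, are uncorrelated, for all locations `s`, `s'`. -/
def ProcessCondIndep {V D Ω : Type*} [MeasurableSpace Ω] (P : Measure Ω) (w : V → D → Ω → ℝ)
    (i j : V) : Prop :=
  ∀ s s' : D, covariance (w i s - P[w i s | sigmaOthers w i j])
    (w j s' - P[w j s' | sigmaOthers w i j]) P = 0

/-- `w` is a graphical Gaussian process with respect to `G`: a multivariate Gaussian process whose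
components `w i`, `w j` are process-level conditionally independent for every non-edge `(i, j)`. -/
structure IsGraphicalGP {V D Ω : Type*} [MeasurableSpace Ω] (G : SimpleGraph V) (P : Measure Ω)
    (w : V → D → Ω → ℝ) : Prop where
  measurable : ∀ i s, Measurable (w i s)
  gaussian : IsGaussianProcess (fun p : V × D => w p.1 p.2) P
  condIndep : ∀ i j, i ≠ j → ¬ G.Adj i j → ProcessCondIndep P w i j

end Stitching

end

/-!
Fix the covariance selection `F` of `C(L, L)` along the strong product of `G` with the complete
graph on `L`. It exists because the determinant attains its maximum over the compact set of positive
semidefinite completions, and stationarity at the maximum says that `F⁻¹` vanishes at the free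
entries (`exists_isCovarianceSelection`); it is unique because the difference of two selections and
the difference of their inverses have disjoint supports (`isCovarianceSelection_unique`). Hence the
law of `w(L)` is the same for all stitched processes.

Writing `a i s` for the weights `C i i (s, L) C i i (L, L)⁻¹` of the predictor, a stitched process
satisfies `w i s = ∑ l, a i s l * w i l + z i s` almost surely at every location, on `L` too: there
the weights are a unit vector and the residual has variance zero. So `w` is Gaussian with covariance
`M i j s t = a i s ⬝ F_ij a j t + [i = j] R i s t`, where `R i` is the residual covariance
(`Stitching.stitchCov`). Since the diagonal blocks of `F` are those of `C(L, L)`, this gives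
`M i i = C i i`, and `M = F` on `L`. On a finite set `S ⊇ L` the quadratic form of `M` is the sum of
the quadratic form of `F` at the coefficients of the predictors and of those of the `C i i` at the
coefficients of the residuals, which makes it positive definite
(`Stitching.isCrossCovariance_stitchCov`).

For existence, a Gaussian process with covariance `M` is realised inside the isonormal process of
the reproducing kernel Hilbert space of `M` (`exists_isonormal`, `exists_isCenteredGP`); the
residuals `z` are then defined as differences, and they have the required independence because
uncorrelated jointly Gaussian processes are independent (`Stitching.isStitched_of_isCenteredGP`).

For the graphical property, let `F⁻¹` have a zero block at `(i, j)`. Choosing `e` supported on the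
block `i` such that `b = F⁻¹ e` equals `a i s` on the block `i`, the vector `b` vanishes on the
block `j` and `F b = e` vanishes off the block `i`. Thus `∑ p, b p * w p + z i s`, which is `w i s`
plus a linear combination of the `w k l` with `k ≠ i, j`, is uncorrelated with every `w k t`,
`k ≠ i`. It is therefore the residual of `w i s` given all components other than `i` and `j`, and it
is uncorrelated with the analogous residual of `w j t`, a combination of the `w k` with `k ≠ i`
(`Stitching.processCondIndep_of_isCenteredGP`).
-/

/-! ### Covariance selection -/

section CovarianceSelection

variable {S : Type*} [Fintype S] [DecidableEq S]

lemma Matrix.PosSemidef.abs_apply_le {A : Matrix S S ℝ} (hA : A.PosSemidef) (r s : S) :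
    |A r s| ≤ (A r r + A s s) / 2 := by
  have hsymm : A s r = A r s := by simpa using hA.1.apply r s
  have key : ∀ c : ℝ, 0 ≤ A r r + 2 * c * A r s + c ^ 2 * A s s := by
    intro c
    have h := hA.dotProduct_mulVec_nonneg (Pi.single r 1 + Pi.single s c)
    simp [mulVec_add, add_dotProduct, hsymm] at h
    nlinarith [h]
  rw [abs_le]
  constructor <;> nlinarith [key 1, key (-1)]

/-- A small perturbation of a symmetric pair of entries of a positive definite matrix leaves it
positive semidefinite, because the matrix dominates a positive multiple of the identity. -/
lemma Matrix.PosDef.eventually_posSemidef_add_smul_single {A : Matrix S S ℝ} (hA : A.PosDef)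
    (r s : S) :
    ∀ᶠ t : ℝ in nhds 0, (A + t • (single r s 1 + single s r 1)).PosSemidef := by
  have : Nonempty S := ⟨r⟩
  open scoped MatrixOrder in
  obtain ⟨ε, hε, hle⟩ := (CFC.exists_pos_algebraMap_le_iff hA.isHermitian).2
    fun x hx => hA.isStrictlyPositive.spectrum_pos hx
  rw [Matrix.le_iff] at hle
  -- the perturbation is dominated by `2 * |t|` times the identity
  filter_upwards [Metric.ball_mem_nhds (0 : ℝ) (half_pos hε)] with t ht
  have ht' : |t| < ε / 2 := by simpa using ht
  have hsplit : A + t • (single r s 1 + single s r 1) =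
      (A - algebraMap ℝ (Matrix S S ℝ) ε) +
        (algebraMap ℝ (Matrix S S ℝ) ε + t • (single r s 1 + single s r 1)) := by abel
  rw [hsplit]
  refine hle.add (.of_dotProduct_mulVec_nonneg ?_ fun y => ?_)
  · ext a b
    simp [single_apply, Matrix.algebraMap_matrix_apply, and_comm, eq_comm]
    ring
  · have hr : y r ^ 2 ≤ ∑ a, y a ^ 2 :=
      Finset.single_le_sum (f := fun a => y a ^ 2) (fun a _ => sq_nonneg _) (Finset.mem_univ r)
    have hs : y s ^ 2 ≤ ∑ a, y a ^ 2 :=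
      Finset.single_le_sum (f := fun a => y a ^ 2) (fun a _ => sq_nonneg _) (Finset.mem_univ s)
    have hval : star y ⬝ᵥ ((algebraMap ℝ (Matrix S S ℝ) ε + t • (single r s 1 + single s r 1)) *ᵥ y)
        = ε * ∑ a, y a ^ 2 + 2 * t * (y r * y s) := by
      have h1 : star y ⬝ᵥ (algebraMap ℝ (Matrix S S ℝ) ε *ᵥ y) = ε * ∑ a, y a ^ 2 := by
        rw [Algebra.algebraMap_eq_smul_one, smul_mulVec, one_mulVec, dotProduct_smul, smul_eq_mul]
        simp [dotProduct, sq]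
      rw [add_mulVec, dotProduct_add, h1, smul_mulVec, add_mulVec, dotProduct_smul,
        dotProduct_add]
      have hsv : ∀ a b, y ⬝ᵥ (single a b (1 : ℝ) *ᵥ y) = y a * y b := fun a b => by
        rw [single_mulVec, ← Pi.single, dotProduct_single, one_mul]
      rw [star_trivial, hsv, hsv, smul_eq_mul]
      ring
    rw [hval]
    have hprod : |y r * y s| ≤ ∑ a, y a ^ 2 := by
      rw [abs_le]; constructor <;> nlinarith [sq_nonneg (y r - y s), sq_nonneg (y r + y s)]
    have hb : |t * (y r * y s)| ≤ ε / 2 * ∑ a, y a ^ 2 := by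
      rw [abs_mul]
      exact mul_le_mul ht'.le hprod (abs_nonneg _) (by positivity)
    linarith [neg_abs_le (t * (y r * y s))]

/-- Jacobi's formula along a line, at an invertible matrix. -/
lemma Matrix.hasDerivAt_det_add_smul {A : Matrix S S ℝ} (hA : IsUnit A.det) (E : Matrix S S ℝ) :
    HasDerivAt (fun t : ℝ => (A + t • E).det) (A.det * (A⁻¹ * E).trace) 0 := by
  have hfac : ∀ t : ℝ, (A + t • E).det = A.det * (1 + t • (A⁻¹ * E)).det := fun t => by
    rw [← det_mul, mul_add, mul_one, Matrix.mul_smul, ← mul_assoc, mul_nonsing_inv A hA, one_mul]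
  rw [funext fun t => (hfac t).trans (congrArg _ (det_one_add_smul t (A⁻¹ * E)))]
  set q := (det (1 + (Polynomial.X : Polynomial ℝ) • (A⁻¹ * E).map Polynomial.C)).divX.divX
  have h2 : HasDerivAt (fun t : ℝ => q.eval t * t ^ 2) 0 0 := by
    simpa using (q.hasDerivAt 0).fun_mul (hasDerivAt_pow 2 (0 : ℝ))
  have h1 : HasDerivAt (fun t : ℝ => 1 + (A⁻¹ * E).trace * t) (A⁻¹ * E).trace 0 := by
    simpa using ((hasDerivAt_id (0 : ℝ)).const_mul (A⁻¹ * E).trace).const_add 1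
  simpa using (h1.add h2).const_mul A.det

lemma Matrix.isClosed_isHermitian {S : Type*} : IsClosed {X : Matrix S S ℝ | X.IsHermitian} := by
  have h : {X : Matrix S S ℝ | X.IsHermitian} = ⋂ r, ⋂ s, {X | X s r = X r s} := by
    ext X
    simp [IsHermitian, ← Matrix.ext_iff]
  rw [h]
  exact isClosed_iInter fun r => isClosed_iInter fun s => isClosed_eq (by fun_prop) (by fun_prop)

/-- The positive semidefinite completions of a partially specified matrix form a compact set:
their entries are controlled by the prescribed diagonal. -/
lemma isCompact_posSemidef_completions (G : SimpleGraph S) (F : Matrix S S ℝ) :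
    IsCompact {X : Matrix S S ℝ | X.PosSemidef ∧ (∀ r, X r r = F r r) ∧
      ∀ r s, G.Adj r s → X r s = F r s} := by
  have hbox : IsCompact (Set.univ.pi fun r => Set.univ.pi fun s =>
      Set.Icc (-((F r r + F s s) / 2)) ((F r r + F s s) / 2) : Set (S → S → ℝ)) :=
    isCompact_univ_pi fun r => isCompact_univ_pi fun s => isCompact_Icc
  refine hbox.of_isClosed_subset ?_ ?_
  · have happ : ∀ r s, Continuous fun X : Matrix S S ℝ => X r s := fun r s => by fun_prop
    simp only [posSemidef_iff_dotProduct_mulVec, and_assoc, Set.ofPred_and, Set.ofPred_forall]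
    refine .inter isClosed_isHermitian (.inter ?_ (.inter ?_ ?_))
    · exact isClosed_iInter fun y => isClosed_le continuous_const (by fun_prop)
    · exact isClosed_iInter fun r => isClosed_eq (happ r r) continuous_const
    · exact isClosed_iInter fun r => isClosed_iInter fun s => isClosed_iInter fun _ =>
        isClosed_eq (happ r s) continuous_const
  · rintro X ⟨hX, hd, -⟩ r - s -
    have := hX.abs_apply_le r s
    rw [hd, hd, abs_le] at this
    exact this

/-- Existence of the covariance selection: the determinant attains its maximum over the compact set
of positive semidefinite completions, and stationarity of the determinant in the free entries says
that the inverse vanishes there. -/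
lemma exists_isCovarianceSelection (G : SimpleGraph S) {F : Matrix S S ℝ} (hF : F.PosDef) :
    ∃ F', Stitching.IsCovarianceSelection G F F' := by
  obtain ⟨A, ⟨hA, hAd, hAe⟩, hmax⟩ := (isCompact_posSemidef_completions G F).exists_isMaxOn
    ⟨F, hF.posSemidef, fun _ => rfl, fun _ _ _ => rfl⟩
    (f := Matrix.det) (by fun_prop)
  have hdet : 0 < A.det :=
    hF.det_pos.trans_le (hmax ⟨hF.posSemidef, fun _ => rfl, fun _ _ _ => rfl⟩)
  have hApos : A.PosDef := hA.posDef_iff_det_ne_zero.2 hdet.ne'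
  refine ⟨A, hApos, hAd, hAe, fun r s hrs hadj => ?_⟩
  have hderiv := Matrix.hasDerivAt_det_add_smul hdet.ne'.isUnit
    (single r s 1 + single s r 1 : Matrix S S ℝ)
  have hloc : IsLocalMax (fun t : ℝ => (A + t • (single r s 1 + single s r 1)).det) 0 := by
    filter_upwards [hApos.eventually_posSemidef_add_smul_single r s] with t ht
    rw [zero_smul, add_zero]
    refine hmax ⟨ht, fun a => ?_, fun a b hab => ?_⟩
    · have h1 : ¬ (r = a ∧ s = a) := fun h => hrs (h.1.trans h.2.symm)
      have h2 : ¬ (s = a ∧ r = a) := fun h => hrs (h.2.trans h.1.symm)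
      simp [h1, h2, hAd]
    · have h1 : ¬ (r = a ∧ s = b) := fun h => hadj (h.1 ▸ h.2 ▸ hab)
      have h2 : ¬ (s = a ∧ r = b) := fun h => hadj (h.1 ▸ h.2 ▸ hab.symm)
      simp [h1, h2, hAe a b hab]
  have hzero := (mul_eq_zero.1 (hloc.hasDerivAt_eq_zero hderiv)).resolve_left hdet.ne'
  have hsymm : A⁻¹ s r = A⁻¹ r s := by simpa using hApos.inv.1.apply r s
  simp [mul_add, trace_mul_single, hsymm] at hzero
  linarith

/-- Uniqueness of the covariance selection. With `Δ = A - B`, the matrices `Δ` and `A⁻¹ - B⁻¹` have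
disjoint supports, so that `0 = -tr (Δ (A⁻¹ - B⁻¹)) = tr (Δ A⁻¹ Δ B⁻¹)`, and the right-hand side is
the squared Frobenius norm of `P Δ Qᴴ`, where `A⁻¹ = Pᴴ P` and `B⁻¹ = Qᴴ Q`. -/
lemma isCovarianceSelection_unique {G : SimpleGraph S} {F A B : Matrix S S ℝ}
    (hA : Stitching.IsCovarianceSelection G F A) (hB : Stitching.IsCovarianceSelection G F B) :
    A = B := by
  have hAu : IsUnit A.det := hA.posDef.det_pos.ne'.isUnit
  have hBu : IsUnit B.det := hB.posDef.det_pos.ne'.isUnit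
  have hinv : A⁻¹ - B⁻¹ = -(A⁻¹ * (A - B) * B⁻¹) := by
    rw [mul_sub, sub_mul, nonsing_inv_mul A hAu, one_mul, mul_assoc, mul_nonsing_inv B hBu, mul_one,
      neg_sub]
  have htr : ((A - B) * (A⁻¹ - B⁻¹)).trace = 0 := by
    simp only [trace, diag, mul_apply]
    refine Finset.sum_eq_zero fun r _ => Finset.sum_eq_zero fun s _ => ?_
    by_cases hrs : r = s
    · subst hrs; simp [hA.eq_diag, hB.eq_diag]
    by_cases hadj : G.Adj r s
    · simp [hA.eq_adj r s hadj, hB.eq_adj r s hadj]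
    · simp [hA.inv_eq_zero s r (Ne.symm hrs) fun h => hadj h.symm,
        hB.inv_eq_zero s r (Ne.symm hrs) fun h => hadj h.symm]
  have hsqrt : ∀ M : Matrix S S ℝ, M.PosSemidef → ∃ P : Matrix S S ℝ, M = Pᴴ * P := fun M hM => by
    open scoped MatrixOrder in
    exact CStarAlgebra.nonneg_iff_eq_star_mul_self.1 hM.nonneg
  obtain ⟨P, hP⟩ := hsqrt A⁻¹ hA.posDef.inv.posSemidef
  obtain ⟨Q, hQ⟩ := hsqrt B⁻¹ hB.posDef.inv.posSemidef
  have hΔ : (A - B)ᴴ = A - B := hA.posDef.1.sub hB.posDef.1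
  have hPQ : P * (A - B) * Qᴴ = 0 := by
    rw [← trace_conjTranspose_mul_self_eq_zero_iff]
    have : (P * (A - B) * Qᴴ)ᴴ * (P * (A - B) * Qᴴ) = Q * ((A - B) * A⁻¹ * (A - B) * Qᴴ) := by
      rw [conjTranspose_mul, conjTranspose_mul, hΔ, conjTranspose_conjTranspose, hP]
      simp only [mul_assoc]
    rw [this, trace_mul_comm, mul_assoc, ← hQ, ← neg_eq_zero, ← trace_neg, ← htr, hinv]
    simp only [mul_assoc, mul_neg]
  have hz : A⁻¹ * (A - B) * B⁻¹ = 0 := by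
    calc A⁻¹ * (A - B) * B⁻¹ = Pᴴ * (P * (A - B) * Qᴴ) * Q := by
          rw [hP, hQ]; simp only [mul_assoc]
      _ = 0 := by rw [hPQ, mul_zero, zero_mul]
  rw [hz, neg_zero, sub_eq_zero] at hinv
  rw [← nonsing_inv_nonsing_inv A hAu, hinv, nonsing_inv_nonsing_inv B hBu]

end CovarianceSelection

namespace Stitching

/-! ### Predictor weights and residual covariances of a positive definite kernel -/

section Kernel

variable {D : Type*} [DecidableEq D]

/-- The matrix `K(S, T)` of a kernel on two finite sets of locations. -/
def kernelMatrix (K : D → D → ℝ) (S T : Finset D) : Matrix S T ℝ :=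
  Matrix.of fun s t => K s t

/-- A scalar kernel is positive definite if all the matrices `K(S, S)` are. -/
def IsPosDefKernel (K : D → D → ℝ) : Prop :=
  ∀ S : Finset D, (kernelMatrix K S S).PosDef

/-- The row vector `K(s, L) K(L, L)⁻¹` of coefficients of the predictor at `s`. -/
noncomputable def weight (K : D → D → ℝ) (L : Finset D) (s : D) : L → ℝ :=
  (fun l : L => K s l) ᵥ* (kernelMatrix K L L)⁻¹

lemma predictor_eq (K : D → D → ℝ) (L : Finset D) (s : D) (y : L → ℝ) :
    predictor K L s y = weight K L s ⬝ᵥ y := by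
  rw [predictor, weight, dotProduct_mulVec]; rfl

variable {K : D → D → ℝ} {L : Finset D}

lemma IsPosDefKernel.symm (hK : IsPosDefKernel K) (s t : D) : K s t = K t s := by
  simpa [kernelMatrix] using
    (hK {s, t}).1.apply (⟨s, by simp⟩ : ({s, t} : Finset D)) ⟨t, by simp⟩ |>.symm

lemma IsPosDefKernel.isUnit_det (hK : IsPosDefKernel K) (S : Finset D) :
    IsUnit (kernelMatrix K S S).det :=
  (hK S).det_pos.ne'.isUnit

lemma weight_of_mem (hK : IsPosDefKernel K) {s : D} (hs : s ∈ L) :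
    weight K L s = Pi.single ⟨s, hs⟩ 1 := by
  have : (fun l : L => K s l) = Pi.single ⟨s, hs⟩ 1 ᵥ* kernelMatrix K L L := by
    rw [single_one_vecMul]; rfl
  rw [weight, this, vecMul_vecMul, mul_nonsing_inv _ (hK.isUnit_det L), vecMul_one]

/-- The normal equations `K(L, L) K(L, L)⁻¹ K(L, s) = K(L, s)`. -/
lemma kernelMatrix_mulVec_weight (hK : IsPosDefKernel K) (s : D) :
    kernelMatrix K L L *ᵥ weight K L s = fun l : L => K l s := by
  have hT : (kernelMatrix K L L)ᵀ = kernelMatrix K L L := by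
    ext a b; exact hK.symm _ _
  rw [weight, ← mulVec_transpose, transpose_nonsing_inv, hT, mulVec_mulVec,
    mul_nonsing_inv _ (hK.isUnit_det L), one_mulVec]
  exact funext fun l => hK.symm _ _

lemma residualCov_of_mem_left (hK : IsPosDefKernel K) {s : D} (hs : s ∈ L) (t : D) :
    residualCov K L s t = 0 := by
  simp [residualCov, predictor_eq, weight_of_mem hK hs]

lemma residualCov_symm (hK : IsPosDefKernel K) (s t : D) :
    residualCov K L s t = residualCov K L t s := by
  simp only [residualCov, predictor_eq, hK.symm s t, ← kernelMatrix_mulVec_weight hK]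
  rw [dotProduct_mulVec, ← mulVec_transpose, dotProduct_comm]
  congr 3
  ext a b; exact hK.symm _ _

lemma residualCov_of_mem_right (hK : IsPosDefKernel K) (s : D) {t : D} (ht : t ∈ L) :
    residualCov K L s t = 0 := by
  rw [residualCov_symm hK, residualCov_of_mem_left hK ht]

lemma weight_dotProduct_kernelMatrix_mulVec_weight_add_residualCov
    (hK : IsPosDefKernel K) (s t : D) :
    weight K L s ⬝ᵥ kernelMatrix K L L *ᵥ weight K L t + residualCov K L s t = K s t := by
  rw [kernelMatrix_mulVec_weight hK, residualCov, predictor_eq]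
  ring

/-- The quadratic form of the residual covariance on a finite set `S ⊇ L` is the quadratic form of
`K` at the coefficients `y` of the linear combination of residuals written in terms of values. -/
lemma sum_residualCov_eq (hK : IsPosDefKernel K) {S : Finset D} (hLS : L ⊆ S) (c : S → ℝ) :
    let y : S → ℝ := fun t => c t -
      if h : (t : D) ∈ L then ∑ s, c s * weight K L s ⟨t, h⟩ else 0
    c ⬝ᵥ Matrix.of (fun s t : S => residualCov K L s t) *ᵥ c = y ⬝ᵥ kernelMatrix K S S *ᵥ y := by
  intro y
  -- `W` collects the weights, and `J` restricts vectors on `S` to `L`; the residuals are the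
  -- values multiplied by `1 - W * J`
  set W : Matrix S L ℝ := Matrix.of fun s l => weight K L s l with hW
  set J : Matrix L S ℝ := (1 : Matrix S S ℝ).submatrix (Set.inclusion hLS) id with hJ
  set R : Matrix S S ℝ := Matrix.of (fun s t : S => residualCov K L s t) with hR
  have hBK : (1 - W * J) * kernelMatrix K S S = R := by
    have h : J * kernelMatrix K S S = kernelMatrix K L S := by
      ext l t
      simp [hJ, mul_apply, one_apply, kernelMatrix]
    rw [Matrix.sub_mul, Matrix.one_mul, Matrix.mul_assoc, h]
    ext s t
    simp [hR, residualCov, predictor_eq, kernelMatrix, hW, mul_apply, dotProduct]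
  have hRJ : R * Jᵀ = 0 := by
    ext s l
    simp [hR, hJ, mul_apply, one_apply, residualCov_of_mem_right hK _ l.2]
  have hy : y = (1 - W * J)ᵀ *ᵥ c := by
    rw [transpose_sub, sub_mulVec, transpose_one, one_mulVec]
    ext t
    by_cases h : (t : D) ∈ L
    · have hl : ∀ l : L, t = Set.inclusion hLS l ↔ l = ⟨t, h⟩ := fun l => by
        simp [Subtype.ext_iff, eq_comm]
      simp [y, h, hJ, hW, mulVec, dotProduct, one_apply, mul_apply, hl, mul_comm]
    · have hl : ∀ l : L, t ≠ Set.inclusion hLS l := fun l hlt => h (hlt ▸ l.2)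
      simp [y, h, hJ, mulVec, dotProduct, one_apply, mul_apply, hl]
  rw [hy, mulVec_transpose, ← dotProduct_mulVec, ← mulVec_transpose, mulVec_mulVec, mulVec_mulVec,
    hBK, transpose_sub, Matrix.mul_sub, transpose_mul, ← Matrix.mul_assoc, hRJ]
  simp

end Kernel

/-! ### The cross-covariance function of a stitched process -/

section StitchCov

variable {V D : Type*} [DecidableEq V] [DecidableEq D]

lemma IsCrossCovariance.isPosDefKernel {V D : Type*} {C : V → V → D → D → ℝ}
    (hC : IsCrossCovariance C) (i : V) : IsPosDefKernel (C i i) := fun S =>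
  (hC S).submatrix (e := fun s : S => (i, s)) fun _ _ h => (Prod.mk.inj h).2

/-- The cross-covariance function of the process stitched from `C` and the covariance matrix `F` of
its values on `L`: the covariance of the predictors, plus that of the independent residuals. -/
noncomputable def stitchCov (C : V → V → D → D → ℝ) (L : Finset D)
    (F : Matrix (V × L) (V × L) ℝ) (i j : V) (s t : D) : ℝ :=
  weight (C i i) L s ⬝ᵥ (Matrix.of fun l l' : L => F (i, l) (j, l')) *ᵥ weight (C j j) L t +
    if i = j then residualCov (C i i) L s t else 0

variable {C : V → V → D → D → ℝ} {L : Finset D} {F : Matrix (V × L) (V × L) ℝ}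

lemma stitchCov_self (hC : IsCrossCovariance C)
    (hdiag : ∀ i l l', F (i, l) (i, l') = C i i l l') (i : V) (s t : D) :
    stitchCov C L F i i s t = C i i s t := by
  have h : (Matrix.of fun l l' : L => F (i, l) (i, l')) = kernelMatrix (C i i) L L := by
    ext l l'; exact hdiag i l l'
  rw [stitchCov, if_pos rfl, h,
    weight_dotProduct_kernelMatrix_mulVec_weight_add_residualCov (hC.isPosDefKernel i)]

lemma stitchCov_of_mem_left (hC : IsCrossCovariance C) (i j : V) (l : L) (t : D) :
    stitchCov C L F i j l t = ∑ l', F (i, l) (j, l') * weight (C j j) L t l' := by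
  have h : (if i = j then residualCov (C i i) L l t else 0) = 0 := by
    rw [residualCov_of_mem_left (hC.isPosDefKernel i) l.2, ite_self]
  rw [stitchCov, h, add_zero, weight_of_mem (hC.isPosDefKernel i) l.2, single_one_dotProduct]
  rfl

lemma stitchCov_of_mem (hC : IsCrossCovariance C) (i j : V) (l l' : L) :
    stitchCov C L F i j l l' = F (i, l) (j, l') := by
  rw [stitchCov_of_mem_left hC, weight_of_mem (hC.isPosDefKernel j) l'.2]
  simp [Pi.single_apply]

lemma stitchCov_eq_sum (hC : IsCrossCovariance C) (i j : V) (s t : D) :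
    stitchCov C L F i j s t = ∑ l : L, weight (C i i) L s l * stitchCov C L F i j l t +
      if i = j then residualCov (C i i) L s t else 0 := by
  simp only [stitchCov_of_mem_left hC]
  rfl

/-- The covariance matrix of the residuals of all the variables on `S`; distinct variables have
uncorrelated residuals. -/
noncomputable def residualMatrix (C : V → V → D → D → ℝ) (L S : Finset D) :
    Matrix (V × S) (V × S) ℝ :=
  Matrix.of fun p q => if p.1 = q.1 then residualCov (C p.1 p.1) L p.2 q.2 else 0

/-- The predictor weights of all the variables, as a block diagonal matrix. -/
noncomputable def weightMatrix (C : V → V → D → D → ℝ) (L S : Finset D) :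
    Matrix (V × S) (V × L) ℝ :=
  Matrix.of fun p q => if p.1 = q.1 then weight (C p.1 p.1) L p.2 q.2 else 0

lemma crossCovMatrix_stitchCov [Fintype V] (S : Finset D) :
    crossCovMatrix (stitchCov C L F) S =
      weightMatrix C L S * F * (weightMatrix C L S)ᵀ + residualMatrix C L S := by
  ext ⟨i, s⟩ ⟨j, t⟩
  simp [crossCovMatrix, stitchCov, weightMatrix, residualMatrix, mul_apply, dotProduct, mulVec,
    Fintype.sum_prod_type, Finset.mul_sum, Finset.sum_mul]
  rw [Finset.sum_comm]
  simp only [mul_assoc]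

lemma isCrossCovariance_stitchCov [Fintype V] (hC : IsCrossCovariance C) (hF : F.PosDef) :
    IsCrossCovariance (stitchCov C L F) := by
  suffices h : ∀ S : Finset D, L ⊆ S → (crossCovMatrix (stitchCov C L F) S).PosDef by
    intro S
    refine (h (L ∪ S) Finset.subset_union_left).submatrix
      (e := fun p : V × S => (p.1, ⟨p.2, Finset.mem_union_right L p.2.2⟩)) ?_
    rintro ⟨i, s⟩ ⟨j, t⟩ h
    simp only [Prod.mk.injEq, Subtype.mk.injEq] at h
    exact Prod.ext h.1 (Subtype.ext h.2)
  intro S hLS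
  rw [crossCovMatrix_stitchCov]
  set W := weightMatrix C L S with hW
  have hWF : (W * F * Wᵀ).PosSemidef := hF.posSemidef.mul_mul_conjTranspose_same W
  have hR : (residualMatrix C L S).IsHermitian := by
    ext ⟨i, s⟩ ⟨j, t⟩
    by_cases hij : i = j
    · subst hij
      simpa [residualMatrix] using residualCov_symm (hC.isPosDefKernel i) _ _
    · simp [residualMatrix, hij, Ne.symm hij]
  refine .of_dotProduct_mulVec_pos (hWF.1.add hR) fun {x} hx => ?_
  -- the linear combination of residuals of the variable `i`, in terms of values of the process
  set y : V → S → ℝ := fun i t => x (i, t) -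
    if h : (t : D) ∈ L then ∑ s : S, x (i, s) * weight (C i i) L s ⟨t, h⟩ else 0 with hy
  have hRx : x ⬝ᵥ residualMatrix C L S *ᵥ x = ∑ i, y i ⬝ᵥ kernelMatrix (C i i) S S *ᵥ y i := by
    simp_rw [hy, ← sum_residualCov_eq (hC.isPosDefKernel _) hLS (fun s => x (_, s))]
    simp [residualMatrix, dotProduct, mulVec, Fintype.sum_prod_type]
  have hWx : x ⬝ᵥ (W * F * Wᵀ) *ᵥ x = (Wᵀ *ᵥ x) ⬝ᵥ F *ᵥ (Wᵀ *ᵥ x) := by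
    rw [← mulVec_mulVec, ← mulVec_mulVec, dotProduct_mulVec, ← mulVec_transpose]
  rw [star_trivial, add_mulVec, dotProduct_add, hRx, hWx]
  have hyi : ∀ i, 0 ≤ y i ⬝ᵥ kernelMatrix (C i i) S S *ᵥ y i := fun i =>
    (hC.isPosDefKernel i S).posSemidef.dotProduct_mulVec_nonneg (y i)
  by_cases hu : Wᵀ *ᵥ x = 0
  · have hyx : ∀ i t, y i t = x (i, t) := by
      intro i t
      rw [hy]
      simp only [sub_eq_self, dite_eq_right_iff]
      intro h
      have := congrFun hu (i, ⟨t, h⟩)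
      simpa [hW, weightMatrix, mulVec, dotProduct, Fintype.sum_prod_type, mul_comm] using this
    obtain ⟨⟨i, t⟩, hit⟩ := Function.ne_iff.1 hx
    have hpos : 0 < y i ⬝ᵥ kernelMatrix (C i i) S S *ᵥ y i :=
      (hC.isPosDefKernel i S).dotProduct_mulVec_pos fun h => hit (by
        rw [← hyx i t]; exact congrFun h t)
    rw [hu, zero_dotProduct, zero_add]
    exact Finset.sum_pos' (fun i _ => hyi i) ⟨i, Finset.mem_univ i, hpos⟩
  · exact add_pos_of_pos_of_nonneg (hF.dotProduct_mulVec_pos hu)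
      (Finset.sum_nonneg fun i _ => hyi i)

/-- If the precision matrix `F⁻¹` has a zero block at `(i, j)`, then `w i s` minus a suitable linear
combination of the values on `L` of the variables other than `i` and `j` is uncorrelated with all
the variables other than `i`. The combination is read off from the vector `F⁻¹ e`, where `e` is
supported on the `i`-th block and is chosen so that the `i`-th block of `F⁻¹ e` is the weight
vector of `s`. -/
lemma exists_coeff_stitchCov_eq [Fintype V] (hC : IsCrossCovariance C) (hF : F.PosDef)
    {i j : V} (hij : i ≠ j) (hzero : ∀ l l', F⁻¹ (j, l) (i, l') = 0) (s : D) :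
    ∃ c : V × L → ℝ, (∀ p, p.1 = i ∨ p.1 = j → c p = 0) ∧
      ∀ k, k ≠ i → ∀ t, stitchCov C L F i k s t = ∑ p, c p * stitchCov C L F p.1 k p.2 t := by
  set Q : Matrix L L ℝ := Matrix.of fun l l' => F⁻¹ (i, l) (i, l') with hQ
  have hQdet : IsUnit Q.det :=
    (hF.inv.submatrix (e := fun l : L => (i, l)) fun _ _ h => (Prod.mk.inj h).2).det_pos.ne'.isUnit
  set e : V × L → ℝ := fun p => if p.1 = i then (Q⁻¹ *ᵥ weight (C i i) L s) p.2 else 0 with he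
  set b : V × L → ℝ := F⁻¹ *ᵥ e with hb
  have hbF : F *ᵥ b = e := by
    rw [hb, mulVec_mulVec, mul_nonsing_inv _ hF.det_pos.ne'.isUnit, one_mulVec]
  have hbi : ∀ l, b (i, l) = weight (C i i) L s l := by
    intro l
    have : (Q *ᵥ (Q⁻¹ *ᵥ weight (C i i) L s)) l = weight (C i i) L s l := by
      rw [mulVec_mulVec, mul_nonsing_inv _ hQdet, one_mulVec]
    rw [← this]
    simp only [hb, he, mulVec, dotProduct, Fintype.sum_prod_type, hQ, of_apply]
    rw [Fintype.sum_eq_single i fun k hk => by simp [hk]]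
    simp
  have hbj : ∀ l, b (j, l) = 0 := by
    intro l
    simp only [hb, he, mulVec, dotProduct, Fintype.sum_prod_type]
    refine Finset.sum_eq_zero fun k _ => Finset.sum_eq_zero fun l' _ => ?_
    by_cases hk : k = i
    · subst hk; rw [hzero, zero_mul]
    · simp [hk]
  refine ⟨fun p => if p.1 = i then 0 else - b p, ?_, fun k hk t => ?_⟩
  · rintro ⟨k, l⟩ (rfl | rfl)
    · simp
    · simp [hbj]
  · have hsum : ∑ p : V × L, b p * stitchCov C L F p.1 k p.2 t = 0 := by
      simp_rw [stitchCov_of_mem_left hC, Finset.mul_sum]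
      rw [Finset.sum_comm]
      refine Finset.sum_eq_zero fun l _ => ?_
      have h := congrFun hbF (k, l)
      rw [he] at h
      simp only [hk, if_false] at h
      have h' : ∑ p : V × L, b p * F p (k, l) = 0 := by
        rw [← h]
        refine Finset.sum_congr rfl fun p _ => ?_
        rw [mul_comm, show F p (k, l) = F (k, l) p by simpa using (hF.1.apply p (k, l)).symm]
      simp_rw [← mul_assoc]
      rw [← Finset.sum_mul, h', zero_mul]
    have hsplit : ∀ f : V × L → ℝ, ∑ p, f p =
        ∑ l, f (i, l) + ∑ p, if p.1 = i then 0 else f p := by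
      intro f
      simp only [Fintype.sum_prod_type]
      rw [← Finset.sum_erase_add _ _ (Finset.mem_univ i)]
      rw [← Finset.sum_erase_add Finset.univ
        (fun k => ∑ l : L, if k = i then (0 : ℝ) else f (k, l)) (Finset.mem_univ i)]
      simp only [if_true, Finset.sum_const_zero, add_zero]
      rw [add_comm]
      congr 1
      refine Finset.sum_congr rfl fun k hk => Finset.sum_congr rfl fun l _ => ?_
      rw [if_neg (Finset.ne_of_mem_erase hk)]
    rw [hsplit] at hsum
    rw [stitchCov_eq_sum hC, if_neg (Ne.symm hk), add_zero]
    simp_rw [← hbi]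
    rw [eq_neg_of_add_eq_zero_left hsum, ← Finset.sum_neg_distrib]
    refine Finset.sum_congr rfl fun p _ => ?_
    split_ifs <;> simp

end StitchCov

end Stitching

/-! ### Existence of Gaussian processes -/

section GaussianExistence

open scoped RealInnerProductSpace ENNReal

lemma integral_sq_Lp_eq_norm_sq {Ω : Type*} [MeasurableSpace Ω] {P : Measure Ω}
    (f : Lp ℝ 2 P) : ∫ ω, f ω ^ 2 ∂P = ‖f‖ ^ 2 := by
  rw [← real_inner_self_eq_norm_sq, L2.inner_def]
  simp [sq]

/-- On `L²` of a probability space, the characteristic function depends continuously on the random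
variable. -/
lemma continuous_charFun_map_Lp {Ω : Type*} [MeasurableSpace Ω] {P : Measure Ω}
    [IsProbabilityMeasure P] (t : ℝ) :
    Continuous fun f : Lp ℝ 2 P => charFun (P.map f) t := by
  have hint : ∀ f : Lp ℝ 2 P, Integrable (fun ω => Complex.exp (t * f ω * Complex.I)) P := by
    intro f
    refine Integrable.of_bound (C := 1) ?_ (ae_of_all _ fun ω => ?_)
    · have := Lp.aestronglyMeasurable f
      fun_prop
    · rw [← Complex.ofReal_mul, Complex.norm_exp_ofReal_mul_I]
  have hchar : ∀ f : Lp ℝ 2 P, charFun (P.map f) t = ∫ ω, Complex.exp (t * f ω * Complex.I) ∂P := by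
    intro f
    rw [charFun_apply_real, integral_map (Lp.aestronglyMeasurable f).aemeasurable (by fun_prop)]
  simp_rw [hchar]
  have hlip : LipschitzWith ‖t‖₊ fun f : Lp ℝ 2 P => ∫ ω, Complex.exp (t * f ω * Complex.I) ∂P := by
    refine LipschitzWith.of_dist_le_mul fun f g => ?_
    have hfg : Integrable (fun ω => f ω - g ω) P :=
      ((Lp.memLp f).sub (Lp.memLp g)).integrable (by norm_num)
    have hpt : ∀ ω, ‖Complex.exp (t * f ω * Complex.I) - Complex.exp (t * g ω * Complex.I)‖ ≤
        |t| * |f ω - g ω| := by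
      intro ω
      have h : Complex.exp (t * f ω * Complex.I) - Complex.exp (t * g ω * Complex.I) =
          Complex.exp ((t * g ω : ℝ) * Complex.I) *
            (Complex.exp (Complex.I * (t * (f ω - g ω) : ℝ)) - 1) := by
        rw [mul_sub, ← Complex.exp_add, mul_one]
        push_cast
        ring_nf
      rw [h, norm_mul, Complex.norm_exp_ofReal_mul_I, one_mul, ← abs_mul]
      exact Real.norm_exp_I_mul_ofReal_sub_one_le
    have hnorm : ∫ ω, |f ω - g ω| ∂P ≤ ‖f - g‖ := by
      have h1 : ∫ ω, |f ω - g ω| ∂P = (eLpNorm (f - g : Lp ℝ 2 P) 1 P).toReal := by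
        rw [eLpNorm_congr_ae (Lp.coeFn_sub f g), eLpNorm_one_eq_lintegral_enorm]
        exact integral_norm_eq_lintegral_enorm hfg.aestronglyMeasurable
      rw [h1, Lp.norm_def]
      exact ENNReal.toReal_mono (Lp.eLpNorm_ne_top _)
        (eLpNorm_le_eLpNorm_of_exponent_le (by norm_num) (Lp.aestronglyMeasurable _))
    rw [dist_eq_norm, dist_eq_norm, ← integral_sub (hint f) (hint g)]
    calc _ ≤ ∫ ω, |t| * |f ω - g ω| ∂P :=
          norm_integral_le_of_norm_le (hfg.abs.const_mul _) (ae_of_all _ hpt)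
      _ ≤ _ := by
          rw [integral_const_mul]
          exact mul_le_mul_of_nonneg_left hnorm (abs_nonneg t)
  exact hlip.continuous

/-- Finite linear combinations of the values of a Gaussian process form a Gaussian process. -/
lemma ProbabilityTheory.IsGaussianProcess.of_mem_span {S T Ω : Type*} [MeasurableSpace Ω]
    {P : Measure Ω} {X : T → Ω → ℝ} {Y : S → Ω → ℝ} (hX : IsGaussianProcess X P)
    (h : ∀ s, Y s ∈ Submodule.span ℝ (Set.range X)) : IsGaussianProcess Y P :=
  hX.of_isGaussianProcess fun s => by
    obtain ⟨c, hc⟩ := Finsupp.mem_span_range_iff_exists_finsupp.1 (h s)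
    refine ⟨c.support, ∑ i : c.support, c i • ContinuousLinearMap.proj i, fun ω => ?_⟩
    rw [← hc, Finsupp.sum, ← Finset.sum_coe_sort]
    simp

/-- The isonormal Gaussian process: a Hilbert space embeds isometrically into a space of square
integrable centred Gaussian random variables. -/
lemma exists_isonormal (H : Type u) [NormedAddCommGroup H] [InnerProductSpace ℝ H]
    [CompleteSpace H] :
    ∃ (Ω : Type u) (_ : MeasurableSpace Ω) (P : Measure Ω) (_ : IsProbabilityMeasure P)
      (W : H →ₗᵢ[ℝ] Lp ℝ 2 P), ∀ h, P.map (W h) = gaussianReal 0 (‖h‖ ^ 2).toNNReal := by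
  obtain ⟨w, b, -⟩ := exists_hilbertBasis ℝ H
  let P : Measure (w → ℝ) := Measure.infinitePi fun _ => gaussianReal 0 1
  have hlaw : ∀ i : w, HasLaw (fun ω : w → ℝ => ω i) (gaussianReal 0 1) P := fun i =>
    ⟨(measurable_pi_apply i).aemeasurable, Measure.infinitePi_map_eval _ i⟩
  have hindep : iIndepFun (fun (i : w) (ω : w → ℝ) => ω i) P :=
    iIndepFun_infinitePi (X := fun _ x => x) fun _ => measurable_id
  have hG : ∀ i : w, HasGaussianLaw (fun ω : w → ℝ => ω i) P := fun i => (hlaw i).hasGaussianLaw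
  let ξ : w → Lp ℝ 2 P := fun i => (hG i).memLp_two.toLp _
  have hξ : ∀ i, ξ i =ᵐ[P] fun ω => ω i := fun i => MemLp.coeFn_toLp _
  have hmean : ∀ i : w, ∫ ω, ω i ∂P = 0 := fun i => by
    rw [(hlaw i).integral_eq]; simp
  have hvar : ∀ i : w, ∫ ω, ω i * ω i ∂P = 1 := fun i => by
    have h := (hlaw i).variance_eq
    rw [variance_eq_integral (hG i).aemeasurable, hmean i] at h
    simpa [sq] using h
  have horth : Orthonormal ℝ ξ := by
    classical
    rw [orthonormal_iff_ite]
    intro i j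
    have h : ⟪ξ i, ξ j⟫ = ∫ ω, ω i * ω j ∂P := by
      rw [L2.inner_def]
      refine integral_congr_ae ?_
      filter_upwards [hξ i, hξ j] with ω hi hj
      simp [hi, hj, mul_comm]
    rw [h]
    split_ifs with hij
    · subst hij; exact hvar i
    · rw [(hindep.indepFun hij).integral_fun_mul_eq_mul_integral
        (hG i).aemeasurable.aestronglyMeasurable
        (hG j).aemeasurable.aestronglyMeasurable, hmean i, zero_mul]
  let W : H →ₗᵢ[ℝ] Lp ℝ 2 P := horth.orthogonalFamily.linearIsometry.comp
    b.repr.toLinearIsometry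
  have hWb : ∀ i, W (b i) = ξ i := by
    intro i
    classical
    simp [W, HilbertBasis.repr_self]
  have hGP : IsGaussianProcess (fun (i : w) (ω : w → ℝ) => ω i) P :=
    ⟨fun I => (hindep.precomp (g := ((↑) : I → w)) Subtype.val_injective).hasGaussianLaw
      fun i => hG i⟩
  have hspan : ∀ h ∈ Submodule.span ℝ (Set.range b), ∫ ω, W h ω ∂P = 0 ∧
      ∃ Y ∈ Submodule.span ℝ (Set.range fun (i : w) (ω : w → ℝ) => ω i), W h =ᵐ[P] Y := by
    have hint : ∀ f : Lp ℝ 2 P, Integrable f P := fun f => (Lp.memLp f).integrable (by norm_num)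
    intro h hh
    induction hh using Submodule.span_induction with
    | mem h hh =>
      obtain ⟨i, rfl⟩ := hh
      rw [hWb]
      exact ⟨by rw [integral_congr_ae (hξ i), hmean], _, Submodule.subset_span ⟨i, rfl⟩, hξ i⟩
    | zero =>
      rw [map_zero]
      refine ⟨?_, 0, zero_mem _, Lp.coeFn_zero ..⟩
      rw [integral_congr_ae (Lp.coeFn_zero ..)]; simp
    | add f g _ _ hf hg =>
      obtain ⟨hf0, Y, hY, hfY⟩ := hf
      obtain ⟨hg0, Z, hZ, hgZ⟩ := hg
      rw [map_add]
      refine ⟨?_, Y + Z, add_mem hY hZ, (Lp.coeFn_add _ _).trans (hfY.add hgZ)⟩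
      rw [integral_congr_ae (Lp.coeFn_add _ _), integral_add' (hint _) (hint _), hf0, hg0, add_zero]
    | smul c f _ hf =>
      obtain ⟨hf0, Y, hY, hfY⟩ := hf
      rw [map_smul]
      refine ⟨?_, c • Y, Submodule.smul_mem _ c hY, (Lp.coeFn_smul c _).trans (hfY.const_smul c)⟩
      rw [integral_congr_ae (Lp.coeFn_smul c _)]
      simp [integral_const_mul, hf0]
  refine ⟨w → ℝ, inferInstance, P, inferInstance, W, fun h => Measure.ext_of_charFun ?_⟩
  ext t
  refine congrFun (Continuous.ext_on (f := fun h => charFun (P.map (W h)) t)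
    (g := fun h => charFun (gaussianReal 0 (‖h‖ ^ 2).toNNReal) t)
    (Submodule.dense_iff_topologicalClosure_eq_top.2 b.dense_span)
    ((continuous_charFun_map_Lp t).comp W.continuous) ?_ fun g hg => ?_) h
  · simp_rw [charFun_gaussianReal]
    fun_prop
  · obtain ⟨h0, Y, hY, hgY⟩ := hspan g hg
    have hlawY : HasGaussianLaw (W g) P :=
      ((hGP.of_mem_span (Y := fun _ : Unit => Y) fun _ => hY).hasGaussianLaw_eval ()).congr
        hgY.symm
    have hvarg : Var[W g; P] = ‖g‖ ^ 2 := by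
      rw [variance_of_integral_eq_zero hlawY.aemeasurable h0, integral_sq_Lp_eq_norm_sq,
        W.norm_map]
    simp only
    rw [hlawY.map_eq_gaussianReal, h0, hvarg]

/-- A positive semidefinite kernel is the Gram kernel of a family of vectors in a Hilbert space. -/
lemma exists_hilbert_of_posSemidef {T : Type u} (K : T → T → ℝ)
    (hK : (Matrix.of K).PosSemidef) :
    ∃ (H : Type u) (_ : NormedAddCommGroup H) (_ : InnerProductSpace ℝ H) (_ : CompleteSpace H)
      (φ : T → H), ∀ s t, ⟪φ s, φ t⟫ = K s t := by
  let K' : Matrix T T (ℝ →L[ℝ] ℝ) := .of fun s t => K t s • 1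
  have hK' : K'.PosSemidef := by
    refine ((RKHS.posSemidef_tfae (K := K')).out 0 2 :
      _ ↔ K'.IsHermitian ∧ ∀ c : T →₀ ℝ, _).2 ⟨?_, fun c => ?_⟩
    · ext s t : 1
      simpa [K'] using congrArg (· • (1 : ℝ →L[ℝ] ℝ)) (hK.1.apply t s)
    · simpa [K', mul_assoc, mul_comm, mul_left_comm] using hK.2 c
  have : Fact K'.PosSemidef := ⟨hK'⟩
  refine ⟨RKHS.OfKernel K', inferInstance, inferInstance, inferInstance,
    fun t => RKHS.kerFun (RKHS.OfKernel K') t 1, fun s t => ?_⟩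
  rw [← RKHS.kernel_inner, RKHS.OfKernel.kernel_ofKernel]
  simp [K']

/-- Every positive semidefinite kernel is the covariance function of a centred Gaussian process. -/
lemma exists_isCenteredGP {T : Type u} (K : T → T → ℝ) (hK : (Matrix.of K).PosSemidef) :
    ∃ (Ω : Type u) (_ : MeasurableSpace Ω) (P : Measure Ω) (_ : IsProbabilityMeasure P)
      (X : T → Ω → ℝ), Stitching.IsCenteredGP X K P := by
  classical
  obtain ⟨H, _, _, _, φ, hφ⟩ := exists_hilbert_of_posSemidef K hK
  obtain ⟨Ω, _, P, _, W, hW⟩ := exists_isonormal H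
  have hmeas : ∀ h, Measurable (W h) := fun h => (Lp.stronglyMeasurable _).measurable
  have hmean : ∀ h, ∫ ω, W h ω ∂P = 0 := fun h => by
    have : ∫ x, x ∂(P.map (W h)) = 0 := by rw [hW]; simp
    rwa [integral_map (hmeas h).aemeasurable (by fun_prop)] at this
  have hcomb : ∀ (I : Finset T) (c : I → ℝ),
      (fun ω => ∑ t, c t * W (φ t) ω) =ᵐ[P] W (∑ t, c t • φ t) := by
    intro I c
    have h : ∀ t : I, (c t • W (φ t) : Lp ℝ 2 P) =ᵐ[P] fun ω => c t * W (φ t) ω :=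
      fun t => Lp.coeFn_smul _ _
    rw [map_sum]
    refine .trans ?_ (Lp.coeFn_finsetSum _ _).symm
    filter_upwards [ae_all_iff.2 h] with ω hω
    simp [Finset.sum_apply, hω]
  refine ⟨Ω, inferInstance, P, inferInstance, fun t => W (φ t), fun t => hmeas _, ⟨fun I => ⟨?_⟩⟩,
    fun t => hmean _, fun s t => ?_⟩
  · refine isGaussian_of_map_eq_gaussianReal fun ℓ =>
      ⟨0, (‖∑ t : I, ℓ (Pi.single t 1) • φ t‖ ^ 2).toNNReal, ?_⟩
    rw [Measure.map_map (by fun_prop) (by fun_prop), ← hW]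
    refine Measure.map_congr (.trans (.of_eq ?_) (hcomb I _))
    ext ω
    change ℓ (fun t : I => W (φ t) ω) = _
    conv_lhs => rw [pi_eq_sum_univ' (fun t : I => W (φ t) ω : I → ℝ), map_sum]
    simp [mul_comm]
  · rw [covariance_eq_sub (Lp.memLp _) (Lp.memLp _), hmean, zero_mul, sub_zero, ← hφ,
      ← W.inner_map_map, L2.inner_def]
    simp [mul_comm]

end GaussianExistence

/-! ### Gaussian processes and independence -/

section Independence

variable {S T Ω : Type*} [MeasurableSpace Ω] {P : Measure Ω}

/-- Two independent Gaussian processes are jointly Gaussian. -/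
lemma ProbabilityTheory.IsGaussianProcess.sumElim_of_indepFun {X : S → Ω → ℝ} {Y : T → Ω → ℝ}
    (hX : IsGaussianProcess X P) (hY : IsGaussianProcess Y P)
    (h : IndepFun (fun ω s => X s ω) (fun ω t => Y t ω) P) :
    IsGaussianProcess (Sum.elim X Y) P where
  hasGaussianLaw I := by
    have hpair := (h.comp (I.toLeft.measurable_restrict (X := fun _ => ℝ))
      (I.toRight.measurable_restrict (X := fun _ => ℝ))).hasGaussianLaw
        (hX.hasGaussianLaw I.toLeft) (hY.hasGaussianLaw I.toRight)
    let ℓ : (I.toLeft → ℝ) × (I.toRight → ℝ) →L[ℝ] I → ℝ := ContinuousLinearMap.pi fun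
      | ⟨.inl s, hs⟩ => .proj ⟨s, Finset.mem_toLeft.2 hs⟩ ∘L .fst ℝ _ _
      | ⟨.inr t, ht⟩ => .proj ⟨t, Finset.mem_toRight.2 ht⟩ ∘L .snd ℝ _ _
    have h : (fun ω => I.restrict (Sum.elim X Y · ω)) =
        ℓ ∘ fun ω => (I.toLeft.restrict (X · ω), I.toRight.restrict (Y · ω)) := by
      funext ω a
      obtain ⟨a | a, ha⟩ := a <;> rfl
    rw [h]
    exact hpair.map ℓ

/-- Finitely many independent Gaussian processes are jointly Gaussian. -/
lemma ProbabilityTheory.IsGaussianProcess.uncurry_of_iIndepFun {V : Type*} [Fintype V]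
    {X : V → T → Ω → ℝ} (hX : ∀ i, IsGaussianProcess (X i) P)
    (h : iIndepFun (fun i ω t => X i t ω) P) :
    IsGaussianProcess (fun p : V × T => X p.1 p.2) P where
  hasGaussianLaw I := by
    classical
    set J : Finset T := I.image Prod.snd
    have hall : HasGaussianLaw (fun ω i => J.restrict (X i · ω)) P :=
      (h.comp (fun _ => J.restrict (π := fun _ => ℝ))
      fun _ => J.measurable_restrict).hasGaussianLaw fun i => (hX i).hasGaussianLaw J
    let ℓ : (V → J → ℝ) →L[ℝ] I → ℝ := ContinuousLinearMap.pi fun p =>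
      .proj (⟨p.1.2, Finset.mem_image_of_mem _ p.2⟩ : J) ∘L .proj p.1.1
    exact hall.map ℓ

lemma ProbabilityTheory.covariance_congr_ae {X X' Y Y' : Ω → ℝ} (hX : X =ᵐ[P] X')
    (hY : Y =ᵐ[P] Y') : covariance X Y P = covariance X' Y' P := by
  rw [covariance, covariance, integral_congr_ae hX, integral_congr_ae hY]
  refine integral_congr_ae ?_
  filter_upwards [hX, hY] with ω h₁ h₂
  rw [h₁, h₂]

/-- If `Y` is measurable with respect to a `σ`-algebra generated by random variables `Z u` that are
jointly Gaussian and uncorrelated with the centred variable `X - Y`, then `Y` is the conditional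
expectation of `X`. -/
lemma condExp_ae_eq_of_covariance_eq_zero {T Ω : Type*} {m mΩ : MeasurableSpace Ω}
    {P : Measure Ω} [IsProbabilityMeasure P] {X Y : Ω → ℝ} {Z : T → Ω → ℝ}
    (hGP : IsGaussianProcess (Sum.elim (fun _ : Unit => X - Y) Z) P)
    (hX : Measurable X) (hY : Measurable Y) (hZ : ∀ t, Measurable (Z t))
    (hYint : Integrable Y P) (hmean : ∫ ω, (X - Y) ω ∂P = 0)
    (hcov : ∀ t, covariance (X - Y) (Z t) P = 0)
    (hm : m ≤ MeasurableSpace.comap (fun ω t => Z t ω) inferInstance)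
    (hYm : StronglyMeasurable[m] Y) :
    P[X | m] =ᵐ[P] Y := by
  have hmle : m ≤ mΩ := hm.trans (measurable_pi_lambda _ hZ).comap_le
  have hint : Integrable (X - Y) P := (hGP.hasGaussianLaw_eval (.inl ())).integrable
  have hindep : IndepFun (fun ω (_ : Unit) => (X - Y) ω) (fun ω t => Z t ω) P :=
    hGP.indepFun_of_covariance_eq_zero (fun _ => (hX.sub hY).aemeasurable)
      (fun t => (hZ t).aemeasurable) fun _ t => hcov t
  have hindep' : Indep (MeasurableSpace.comap (X - Y) inferInstance) m P := by
    have h1 := hindep.comp (measurable_pi_apply ()) measurable_id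
    exact indep_of_indep_of_le_right h1 hm
  have hzero : P[X - Y | m] =ᵐ[P] fun _ => 0 := by
    rw [← hmean]
    exact condExp_indep_eq (hX.sub hY).comap_le hmle
      (comap_measurable (X - Y)).stronglyMeasurable hindep'
  have hsplit : P[X | m] =ᵐ[P] P[X - Y | m] + P[Y | m] := by
    conv_lhs => rw [← sub_add_cancel X Y]
    exact condExp_add hint hYint m
  rw [condExp_of_stronglyMeasurable hmle hYm hYint] at hsplit
  filter_upwards [hsplit, hzero] with ω h1 h2
  rw [h1, Pi.add_apply, h2, zero_add]

end Independence

namespace Stitching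

/-! ### Stitched processes -/

section Stitched

variable {V D Ω : Type*} [DecidableEq V] [DecidableEq D] [MeasurableSpace Ω]
  {P : Measure Ω} {C : V → V → D → D → ℝ} {G : SimpleGraph V} {L : Finset D}
  {F : Matrix (V × L) (V × L) ℝ} {w : V → D → Ω → ℝ}

lemma IsCenteredGP.memLp_two {T : Type*} {X : T → Ω → ℝ} {K : T → T → ℝ}
    (hX : IsCenteredGP X K P) (t : T) : MemLp (X t) 2 P :=
  (hX.gaussian.hasGaussianLaw_eval t).memLp_two

lemma IsCenteredGP.integrable {T : Type*} {X : T → Ω → ℝ} {K : T → T → ℝ}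
    (hX : IsCenteredGP X K P) (t : T) : Integrable (X t) P :=
  (hX.gaussian.hasGaussianLaw_eval t).integrable

lemma IsCenteredGP.comp_right {S T : Type*} {X : T → Ω → ℝ} {K : T → T → ℝ}
    (hX : IsCenteredGP X K P) (f : S → T) :
    IsCenteredGP (fun s => X (f s)) (fun s s' => K (f s) (f s')) P :=
  ⟨fun _ => hX.measurable _, hX.gaussian.comp_right f, fun _ => hX.mean_zero _,
    fun _ _ => hX.covariance_eq _ _⟩

lemma IsCenteredGP.measurable_sum_smul {T ι : Type*} [Fintype ι] {X : T → Ω → ℝ} {K : T → T → ℝ}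
    (hX : IsCenteredGP X K P) (c : ι → ℝ) (f : ι → T) : Measurable (∑ l, c l • X (f l)) := by
  rw [Finset.sum_fn]
  exact Finset.measurable_sum _ fun l _ => (hX.measurable (f l)).const_smul (c l)

lemma IsCenteredGP.integral_sum_smul {T ι : Type*} [Fintype ι] {X : T → Ω → ℝ} {K : T → T → ℝ}
    (hX : IsCenteredGP X K P) (c : ι → ℝ) (f : ι → T) :
    ∫ ω, (∑ l, c l • X (f l)) ω ∂P = 0 := by
  simp only [Finset.sum_apply, Pi.smul_apply, smul_eq_mul]
  rw [integral_finsetSum _ fun l _ => (hX.integrable (f l)).const_mul (c l)]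
  simp [integral_const_mul, hX.mean_zero]

/-- Pairs with the same variable are edges of the strong product with the complete graph, so the
covariance selection keeps the covariance of each single variable. -/
lemma IsCovarianceSelection.eq_of_fst_eq [Fintype V]
    (hF : IsCovarianceSelection (strongProduct G (⊤ : SimpleGraph L)) (crossCovMatrix C L) F)
    (i : V) (l l' : L) : F (i, l) (i, l') = C i i l l' := by
  by_cases h : l = l'
  · subst h; exact hF.eq_diag _
  · exact hF.eq_adj _ _ (Or.inl ⟨rfl, h⟩)

lemma IsCovarianceSelection.eq_of_adj [Fintype V]
    (hF : IsCovarianceSelection (strongProduct G (⊤ : SimpleGraph L)) (crossCovMatrix C L) F)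
    {i j : V} (hij : G.Adj i j) (l l' : L) : F (i, l) (j, l') = C i j l l' := by
  refine hF.eq_adj _ _ ?_
  by_cases h : l = l'
  · exact Or.inr (Or.inl ⟨h, hij⟩)
  · exact Or.inr (Or.inr ⟨hij, h⟩)

lemma IsCovarianceSelection.inv_eq_zero_of_not_adj [Fintype V]
    (hF : IsCovarianceSelection (strongProduct G (⊤ : SimpleGraph L)) (crossCovMatrix C L) F)
    {i j : V} (hij : i ≠ j) (hadj : ¬ G.Adj i j) (l l' : L) : F⁻¹ (i, l) (j, l') = 0 := by
  refine hF.inv_eq_zero _ _ (fun h => hij (Prod.mk.inj h).1) ?_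
  rintro (⟨h, -⟩ | ⟨-, h⟩ | ⟨h, -⟩)
  exacts [hij h, hadj h, hadj h]

/-- A stitched process is a centred Gaussian process with covariance `stitchCov`. -/
lemma IsStitched.isCenteredGP [Fintype V] [IsProbabilityMeasure P] (hC : IsCrossCovariance C)
    (hF : IsCovarianceSelection (strongProduct G (⊤ : SimpleGraph L)) (crossCovMatrix C L) F)
    (hw : IsStitched C G L P w) :
    IsCenteredGP (fun p : V × D => w p.1 p.2)
      (fun p q => stitchCov C L F p.1 q.1 p.2 q.2) P := by
  obtain ⟨F', hF', hX⟩ := hw.onL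
  obtain rfl := isCovarianceSelection_unique hF' hF
  obtain ⟨z, hz, hzi, hzX, hoff⟩ := hw.offL
  have hX2 : ∀ p : V × L, MemLp (w p.1 p.2) 2 P := hX.memLp_two
  have hz2 : ∀ i s, MemLp (z i s) 2 P := fun i s => (hz i).memLp_two s
  -- predictors plus residuals, which form a Gaussian process equal to `w` almost surely
  set A : V × D → Ω → ℝ := fun p => ∑ l : L, weight (C p.1 p.1) L p.2 l • w p.1 l with hA
  have hA2 : ∀ p, MemLp (A p) 2 P := fun p =>
    memLp_finsetSum' _ fun l _ => (hX2 (p.1, l)).const_smul _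
  have hae : ∀ p : V × D, A p + z p.1 p.2 =ᵐ[P] w p.1 p.2 := by
    rintro ⟨i, s⟩
    by_cases hs : s ∈ L
    · have hvar : Var[z i s; P] = 0 := by
        rw [← covariance_self (hz2 i s).aemeasurable, (hz i).covariance_eq,
          residualCov_of_mem_left (hC.isPosDefKernel i) hs]
      filter_upwards [ae_eq_integral_of_variance_eq_zero (hz2 i s) hvar] with ω hω
      rw [(hz i).mean_zero] at hω
      simp [hA, weight_of_mem (hC.isPosDefKernel i) hs, hω, Pi.single_apply]
    · refine .of_forall fun ω => ?_
      rw [hoff i s hs ω, predictor_eq]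
      simp [hA, dotProduct]
  have hjoint := (IsGaussianProcess.uncurry_of_iIndepFun (fun i => (hz i).gaussian)
    hzi).sumElim_of_indepFun hX.gaussian hzX
  have hGP : IsGaussianProcess (fun p : V × D => A p + z p.1 p.2) P := by
    refine hjoint.of_mem_span fun p => add_mem (sum_mem fun l _ => Submodule.smul_mem _ _ ?_) ?_
    · exact Submodule.subset_span ⟨Sum.inr (p.1, l), rfl⟩
    · exact Submodule.subset_span ⟨Sum.inl p, rfl⟩
  have hcovX : ∀ (i j : V) (l l' : L), covariance (w i l) (w j l') P = F' (i, l) (j, l') :=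
    fun i j l l' => hX.covariance_eq (i, l) (j, l')
  have hcovzX : ∀ (i j : V) (s : D) (l : L), covariance (z i s) (w j l) P = 0 := fun i j s l =>
    (hzX.comp (measurable_pi_apply (i, s)) (measurable_pi_apply (j, l))).covariance_eq_zero
      (hz2 i s) (hX2 (j, l))
  have hcovz : ∀ (i j : V) (s t : D), covariance (z i s) (z j t) P =
      if i = j then residualCov (C i i) L s t else 0 := by
    intro i j s t
    split_ifs with hij
    · subst hij; exact (hz i).covariance_eq s t
    · exact ((hzi.indepFun hij).comp (measurable_pi_apply s)
        (measurable_pi_apply t)).covariance_eq_zero (hz2 i s) (hz2 j t)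
  have hcovzA : ∀ (i : V) (s : D) (p : V × D), covariance (z i s) (A p) P = 0 := by
    intro i s p
    rw [hA, covariance_sum_right (fun l => (hX2 (p.1, l)).const_smul _) (hz2 i s)]
    exact Finset.sum_eq_zero fun l _ => by rw [covariance_smul_right, hcovzX, mul_zero]
  refine ⟨fun p => hw.measurable _ _, hGP.congr hae, fun p => ?_, fun p q => ?_⟩
  · rw [← integral_congr_ae (hae p), integral_add' ((hA2 p).integrable (by norm_num))
      ((hz p.1).integrable p.2), (hz p.1).mean_zero, add_zero]
    exact hX.integral_sum_smul _ fun l => (p.1, l)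
  · rw [← covariance_congr_ae (hae p) (hae q), covariance_add_left (hA2 p) (hz2 _ _)
      ((hA2 q).add (hz2 _ _)), covariance_add_right (hA2 p) (hA2 q) (hz2 _ _),
      covariance_add_right (hz2 _ _) (hA2 q) (hz2 _ _), covariance_comm (A p) (z _ _),
      hcovzA, hcovzA, add_zero, zero_add, hcovz, stitchCov, hA,
      covariance_sum_sum (fun l => (hX2 (p.1, l)).const_smul _)
        fun l => (hX2 (q.1, l)).const_smul _]
    congr 1
    simp only [covariance_smul_left, covariance_smul_right, hcovX, dotProduct, mulVec,
      Finset.mul_sum, of_apply]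
    exact Finset.sum_congr rfl fun l _ => Finset.sum_congr rfl fun l' _ => by ring

/-- Conversely, a centred Gaussian process with covariance `stitchCov` is stitched: its residuals
are the differences between its values and their predictors. -/
lemma isStitched_of_isCenteredGP [Fintype V] [IsProbabilityMeasure P] (hC : IsCrossCovariance C)
    (hF : IsCovarianceSelection (strongProduct G (⊤ : SimpleGraph L)) (crossCovMatrix C L) F)
    (hw : IsCenteredGP (fun p : V × D => w p.1 p.2)
      (fun p q => stitchCov C L F p.1 q.1 p.2 q.2) P) :
    IsStitched C G L P w := by
  have hw2 : ∀ i s, MemLp (w i s) 2 P := fun i s => hw.memLp_two (i, s)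
  have hcovw : ∀ i j s t, covariance (w i s) (w j t) P = stitchCov C L F i j s t :=
    fun i j s t => hw.covariance_eq (i, s) (j, t)
  have hspan : ∀ i s, w i s ∈ Submodule.span ℝ (Set.range fun p : V × D => w p.1 p.2) :=
    fun i s => Submodule.subset_span ⟨(i, s), rfl⟩
  set A : V → D → Ω → ℝ := fun i s => ∑ l : L, weight (C i i) L s l • w i l with hA
  have hA2 : ∀ i s, MemLp (A i s) 2 P := fun i s =>
    memLp_finsetSum' _ fun l _ => (hw2 i l).const_smul _
  have hz2 : ∀ i s, MemLp (w i s - A i s) 2 P := fun i s => (hw2 i s).sub (hA2 i s)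
  have hzspan : ∀ i s, w i s - A i s ∈
      Submodule.span ℝ (Set.range fun p : V × D => w p.1 p.2) := fun i s =>
    sub_mem (hspan i s) (sum_mem fun l _ => Submodule.smul_mem _ _ (hspan i l))
  have hzmeas : ∀ i s, Measurable (w i s - A i s) := fun i s =>
    (hw.measurable (i, s)).sub (hw.measurable_sum_smul _ fun l : L => (i, (l : D)))
  have hcovzw : ∀ i j s t, covariance (w i s - A i s) (w j t) P =
      if i = j then residualCov (C i i) L s t else 0 := by
    intro i j s t
    rw [covariance_sub_left (hw2 i s) (hA2 i s) (hw2 j t), hcovw, stitchCov_eq_sum hC, hA,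
      covariance_sum_left (fun l : L => (hw2 i l).const_smul _) (hw2 j t)]
    simp only [covariance_smul_left, hcovw, add_sub_cancel_left]
  have hcovz : ∀ i j s t, covariance (w i s - A i s) (w j t - A j t) P =
      if i = j then residualCov (C i i) L s t else 0 := by
    intro i j s t
    have h0 : covariance (w i s - A i s) (A j t) P = 0 := by
      rw [hA, covariance_sum_right (fun l : L => (hw2 j l).const_smul _) (hz2 i s)]
      refine Finset.sum_eq_zero fun l _ => ?_
      rw [covariance_smul_right, hcovzw, residualCov_of_mem_right (hC.isPosDefKernel i) _ l.2,
        ite_self, mul_zero]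
    rw [covariance_sub_right (hz2 i s) (hw2 j t) (hA2 j t), hcovzw, h0, sub_zero]
  have hzGP : IsGaussianProcess (fun p : V × D => w p.1 p.2 - A p.1 p.2) P :=
    hw.gaussian.of_mem_span fun p => hzspan _ _
  refine ⟨fun i s => hw.measurable (i, s), ⟨F, hF, ?_⟩, fun i s => w i s - A i s, ?_, ?_, ?_, ?_⟩
  · have hFL : F = fun p q : V × L => stitchCov C L F p.1 q.1 p.2 q.2 :=
      funext₂ fun p q => (stitchCov_of_mem hC _ _ _ _).symm
    rw [hFL]
    exact hw.comp_right fun p : V × L => (p.1, (p.2 : D))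
  · refine fun i => ⟨hzmeas i, hzGP.comp_right fun s => (i, s), fun s => ?_, fun s t => ?_⟩
    · rw [integral_sub' (hw.integrable (i, s)) ((hA2 i s).integrable (by norm_num))]
      rw [hw.mean_zero (i, s), zero_sub, neg_eq_zero]
      exact hw.integral_sum_smul _ fun l : L => (i, (l : D))
    · rw [hcovz, if_pos rfl]
  · refine IsGaussianProcess.iIndepFun_of_covariance_eq_zero (X := fun i s => w i s - A i s)
      (hzGP.comp_right fun p : (_ : V) × D => (p.1, p.2)) (fun i s => (hzmeas i s).aemeasurable)
      fun i j hij s t => ?_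
    rw [hcovz, if_neg hij]
  · refine IsGaussianProcess.indepFun_of_covariance_eq_zero
      (X := fun p : V × D => w p.1 p.2 - A p.1 p.2) (Y := fun p : V × L => w p.1 p.2)
      (hw.gaussian.of_mem_span ?_) (fun p => (hzmeas _ _).aemeasurable)
      (fun p => (hw.measurable (p.1, (p.2 : D))).aemeasurable) fun p q => ?_
    · rintro (p | p)
      exacts [hzspan _ _, hspan _ _]
    · rw [hcovzw, residualCov_of_mem_right (hC.isPosDefKernel _) _ q.2.2, ite_self]
  · intro i s hs ω
    rw [predictor_eq]
    simp [hA, dotProduct]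

/-- If the covariance selection has no edge between `i` and `j`, the corresponding components are
conditionally independent given all the others. The predictor of `w i s` from the other components
uses only their values on `L`, and its error is uncorrelated even with `w j`, hence with the
prediction error of `w j t`. -/
lemma processCondIndep_of_isCenteredGP [Fintype V] [IsProbabilityMeasure P]
    (hC : IsCrossCovariance C)
    (hF : F.PosDef) (hw : IsCenteredGP (fun p : V × D => w p.1 p.2)
      (fun p q => stitchCov C L F p.1 q.1 p.2 q.2) P) {i j : V} (hij : i ≠ j)
    (hzero : ∀ l l', F⁻¹ (i, l) (j, l') = 0) : ProcessCondIndep P w i j := by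
  have hw2 : ∀ i s, MemLp (w i s) 2 P := fun i s => hw.memLp_two (i, s)
  have hcovw : ∀ i j s t, covariance (w i s) (w j t) P = stitchCov C L F i j s t :=
    fun i j s t => hw.covariance_eq (i, s) (j, t)
  have hzero' : ∀ l l', F⁻¹ (j, l) (i, l') = 0 := fun l l' => by
    have h := hF.inv.1.apply (i, l') (j, l)
    rw [hzero] at h
    simpa using h
  have hspan : ∀ i s, w i s ∈ Submodule.span ℝ (Set.range fun p : V × D => w p.1 p.2) :=
    fun i s => Submodule.subset_span ⟨(i, s), rfl⟩
  -- the predictor, given by coefficients `c` that vanish on the components `i` and `j`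
  have key : ∀ a : V, (a = i ∨ a = j) → ∀ (s : D) (c : V × L → ℝ),
      (∀ p, p.1 = i ∨ p.1 = j → c p = 0) →
      (∀ k, k ≠ a → ∀ t, stitchCov C L F a k s t = ∑ p, c p * stitchCov C L F p.1 k p.2 t) →
      (∀ k, k ≠ a → ∀ t, covariance (w a s - ∑ p, c p • w p.1 p.2) (w k t) P = 0) ∧
      P[w a s | sigmaOthers w i j] =ᵐ[P] ∑ p, c p • w p.1 p.2 := by
    intro a ha s c hc0 hc
    have hY2 : MemLp (∑ p : V × L, c p • w p.1 p.2) 2 P :=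
      memLp_finsetSum' _ fun p _ => (hw2 _ _).const_smul _
    have hcov : ∀ k, k ≠ a → ∀ t, covariance (w a s - ∑ p, c p • w p.1 p.2) (w k t) P = 0 := by
      intro k hk t
      rw [covariance_sub_left (hw2 _ _) hY2 (hw2 _ _),
        covariance_sum_left (fun p => (hw2 _ _).const_smul _) (hw2 _ _), hcovw, hc k hk]
      simp only [covariance_smul_left, hcovw, sub_self]
    refine ⟨hcov, ?_⟩
    refine condExp_ae_eq_of_covariance_eq_zero
      (Z := fun q : {q : V × D // q.1 ≠ i ∧ q.1 ≠ j} => w q.1.1 q.1.2)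
      (hw.gaussian.of_mem_span ?_) (hw.measurable (a, s))
      (hw.measurable_sum_smul c fun p : V × L => (p.1, (p.2 : D)))
      (fun q => hw.measurable q.1) (hY2.integrable (by norm_num)) ?_ (fun q => hcov _ ?_ _)
      ?_ ?_
    · rintro (- | q)
      · exact sub_mem (hspan _ _) (sum_mem fun p _ => Submodule.smul_mem _ _ (hspan _ _))
      · exact hspan _ _
    · rw [integral_sub' (hw.integrable (a, s)) (hY2.integrable (by norm_num))]
      rw [hw.mean_zero (a, s), zero_sub, neg_eq_zero]
      exact hw.integral_sum_smul c fun p : V × L => (p.1, (p.2 : D))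
    · rintro rfl
      exact ha.elim q.2.1 q.2.2
    · refine iSup_le fun k => iSup_le fun hk => iSup_le fun t => ?_
      let q₀ : {q : V × D // q.1 ≠ i ∧ q.1 ≠ j} := ⟨(k, t), hk⟩
      exact ((measurable_pi_apply (X := fun _ => ℝ) q₀).comp (comap_measurable
        fun ω (q : {q : V × D // q.1 ≠ i ∧ q.1 ≠ j}) => w q.1.1 q.1.2 ω)).comap_le
    · refine Finset.stronglyMeasurable_sum _ fun p _ => ?_
      by_cases hp : p.1 = i ∨ p.1 = j
      · rw [hc0 p hp, zero_smul]
        exact stronglyMeasurable_zero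
      · rw [not_or] at hp
        refine StronglyMeasurable.const_smul (Measurable.stronglyMeasurable ?_) _
        exact (comap_measurable (w p.1 p.2)).mono (le_iSup_of_le p.1 (le_iSup_of_le hp
          (le_iSup_of_le (p.2 : D) le_rfl))) le_rfl
  intro s t
  obtain ⟨c, hc0, hc⟩ := exists_coeff_stitchCov_eq hC hF hij hzero' s
  obtain ⟨d, hd0, hd⟩ := exists_coeff_stitchCov_eq hC hF hij.symm hzero t
  obtain ⟨hcov, hce⟩ := key i (Or.inl rfl) s c hc0 hc
  obtain ⟨-, hde⟩ := key j (Or.inr rfl) t d (fun p hp => hd0 p hp.symm) hd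
  have hρ2 : MemLp (w i s - ∑ p : V × L, c p • w p.1 p.2) 2 P :=
    (hw2 _ _).sub (memLp_finsetSum' _ fun p _ => (hw2 _ _).const_smul _)
  rw [covariance_congr_ae (.sub .rfl hce) (.sub .rfl hde),
    covariance_sub_right hρ2 (hw2 _ _) (memLp_finsetSum' _ fun p _ => (hw2 _ _).const_smul _),
    hcov j hij.symm, zero_sub, neg_eq_zero,
    covariance_sum_right (fun p => (hw2 _ _).const_smul _) hρ2]
  refine Finset.sum_eq_zero fun p _ => ?_
  rw [covariance_smul_right]
  by_cases hp : p.1 = i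
  · rw [hd0 p (Or.inr hp), zero_mul]
  · rw [hcov _ hp, mul_zero]

end Stitched

end Stitching

namespace Stitching

/-! ### Existence and properties of stitched processes -/

/-- A cross-covariance function is a positive semidefinite kernel on variable-location pairs. -/
lemma IsCrossCovariance.posSemidef {V D : Type*} [Finite V] {M : V → V → D → D → ℝ}
    (hM : IsCrossCovariance M) :
    (Matrix.of fun p q : V × D => M p.1 q.1 p.2 q.2).PosSemidef := by
  classical
  have := Fintype.ofFinite V
  refine ⟨?_, fun c => ?_⟩
  · ext p q
    have h := (hM {p.2, q.2}).1.apply (p.1, (⟨p.2, by simp⟩ : ({p.2, q.2} : Finset D)))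
      (q.1, ⟨q.2, by simp⟩)
    simpa [crossCovMatrix] using h
  · set S : Finset D := c.support.image Prod.snd
    have hS : c.support ⊆ Finset.univ ×ˢ S := fun p hp =>
      Finset.mem_product.2 ⟨Finset.mem_univ _, Finset.mem_image_of_mem _ hp⟩
    have h := (hM S).posSemidef.dotProduct_mulVec_nonneg fun p : V × S => c (p.1, p.2)
    have hsum : ∀ f : V × D → ℝ, ∑ p ∈ Finset.univ ×ˢ S, f p = ∑ p : V × S, f (p.1, p.2) := by
      intro f
      rw [Finset.sum_product, Fintype.sum_prod_type]
      exact Finset.sum_congr rfl fun i _ => (Finset.sum_coe_sort S fun s => f (i, s)).symm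
    rw [Finsupp.sum_of_support_subset _ hS _ (by simp), hsum]
    simp_rw [Finsupp.sum_of_support_subset _ hS _
      (fun _ _ => mul_zero _), hsum]
    simpa [dotProduct, mulVec, crossCovMatrix, Finset.mul_sum, mul_assoc] using h

end Stitching

theorem theorem2 {V : Type u} [Fintype V] [DecidableEq V] {D : Type v} [DecidableEq D]
    (C : V → V → D → D → ℝ) (hC : Stitching.IsCrossCovariance C)
    (G : SimpleGraph V) (L : Finset D) :
    ∃ M : V → V → D → D → ℝ,
      Stitching.IsCrossCovariance M ∧
      (∃ (Ω : Type (max u v x)) (_ : MeasurableSpace Ω) (P : Measure Ω) (_ : IsProbabilityMeasure P)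
        (w : V → D → Ω → ℝ), Stitching.IsStitched C G L P w) ∧
      (∀ (Ω : Type (max u v x)) [MeasurableSpace Ω] (P : Measure Ω) [IsProbabilityMeasure P]
        (w : V → D → Ω → ℝ), Stitching.IsStitched C G L P w →
          Stitching.IsCenteredGP (fun p : V × D => w p.1 p.2)
            (fun p p' => M p.1 p'.1 p.2 p'.2) P ∧
          (∀ i, Stitching.IsCenteredGP (w i) (C i i) P) ∧
          Stitching.IsGraphicalGP G P w) ∧
      (∀ i s s', M i i s s' = C i i s s') ∧
      (∀ i j, G.Adj i j → ∀ s ∈ L, ∀ s' ∈ L, M i j s s' = C i j s s') := by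
  obtain ⟨F, hF⟩ := exists_isCovarianceSelection
    (Stitching.strongProduct G (⊤ : SimpleGraph L)) (hC L)
  have hM := Stitching.isCrossCovariance_stitchCov (L := L) hC hF.posDef
  have hself := Stitching.stitchCov_self (L := L) hC hF.eq_of_fst_eq
  refine ⟨Stitching.stitchCov C L F, hM, ?_, ?_, hself, ?_⟩
  · -- lifting the index set puts the probability space into the required universe
    obtain ⟨Ω, _, P, _, X, hX⟩ := exists_isCenteredGP
      (fun p q : ULift.{x} (V × D) =>
        Stitching.stitchCov C L F p.down.1 q.down.1 p.down.2 q.down.2)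
      (hM.posSemidef.submatrix ULift.down)
    exact ⟨Ω, inferInstance, P, inferInstance, fun i s => X ⟨(i, s)⟩,
      Stitching.isStitched_of_isCenteredGP hC hF (hX.comp_right fun p : V × D => ⟨p⟩)⟩
  · intro Ω _ P _ w hw
    have hGP := hw.isCenteredGP hC hF
    refine ⟨hGP, fun i => ?_, hw.measurable, hGP.gaussian, fun i j hij hadj => ?_⟩
    · have h := hGP.comp_right fun s => (i, s)
      simpa only [hself] using h
    · exact Stitching.processCondIndep_of_isCenteredGP hC hF.posDef hGP hij
        (hF.inv_eq_zero_of_not_adj hij hadj)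
  · intro i j hij s hs s' hs'
    exact (Stitching.stitchCov_of_mem hC i j ⟨s, hs⟩ ⟨s', hs'⟩).trans
      (hF.eq_of_adj hij ⟨s, hs⟩ ⟨s', hs'⟩)
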